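/- Normalised norms: for a measurable set $E$ of finite positive measure $\mu(E)$ put $\|f\|_{L^q(E)}=\big(\frac1{\mu(E)}\int_E|f|^q\,d\mu\big)^{1/q}$ for $q>0$ and $\|f\|_{L^0(E)}=\exp\big(\frac1{\mu(E)}\int_E\log|f|\,d\mu\big)$. Let $\mathbb T$ be the unit circle with Lebesgue measure $\mu$ normalised by $\mu(\mathbb T)=1$. We say that the Turán–Nazarov inequality holds with constant $A\in\mathbb R$ if $$\|P\|_{L^q(E)}\ \ge\ e^{-A\,n\,\mu(\mathbb T\setminus E)}\,\|P\|_{L^q(\mathbb T)}$$ for all $0\le q\le 2$, all integers $n\ge 0$, all nonzero trigonometric polynomials $P(z)=\sum_{k=1}^{n+1}a_kz^{\alpha_k}$ with $a_k\in\mathbb C$ and distinct $\alpha_k\in\mathbb N$, and all measurable $E\subset\mathbb T$ with $\mu(E)\ge\frac13$. For $W\in(0,\frac12)$ and an integer $N\ge1$, let $v^{(0)},\dots,v^{(N-1)}\in\mathbb R^N$ be orthonormal eigenvectors of the Toeplitz matrix $\Big[\frac{\sin(2\pi W(i-j))}{\pi(i-j)}\Big]_{0\le i,j\le N-1}$ (with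 diagonal entries $2W$), ordered by decreasing eigenvalues $\widetilde\lambda_{0,N}(W)\ge\dots\ge\widetilde\lambda_{N-1,N}(W)$, and let $$U_{k,W}^N(x)=\epsilon_k\sum_{j=0}^{N-1}v^{(k)}_j\,e^{-i\pi(N-1-2j)x},\qquad \epsilon_k=1\ (k\text{ even}),\quad \epsilon_k=i\ (k\text{ odd}),$$ be the discrete prolate spheroidal wave functions (DPSWFs). Let $A\in\mathbb R$. 1. If the Turán–Nazarov inequality holds with constant $A$, then $$A\ \ge\ \frac{2}{1-2/6}\,\log\Big(\frac{12}{e\pi}\Big).$$ 2. The same lower bound for $A$ already follows if the inequality holds with constant $A$ merely for $q=2$, the arc $(-W,W)$ with $W=\frac16$ and the DPSWF of index $n=N-1$, that is, if for infinitely many $N$ $$\big\|U^N_{N-1,1/6}\big\|_{L^2(-1/6,1/6)}\ \ge\ e^{-A(N-1)(1-2/6)}\,\big\|U^N_{N-1,1/6}\big\|_{L^2(-1/2,1/2)} .$$ 3. Numerically, $\Big|\frac{2}{1-2/6}\log\big(\frac{12}{e\pi}\big)-1.02\Big|<0.005$. -/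

import Mathlib

open MeasureTheory Filter

noncomputable section

/-- The normalised `L^q` norm of `f` on `E`, `0 ≤ q < ∞`:
`(μ(E)⁻¹ ∫_E |f|^q)^(1/q)` for `q ≠ 0`, and the geometric mean `exp (μ(E)⁻¹ ∫_E log |f|)`
(the limit as `q → 0`) for `q = 0`. -/
def meanNorm {X : Type*} [MeasureSpace X] (q : ℝ) (E : Set X) (f : X → ℂ) : ℝ :=
  if q = 0 then Real.exp (⨍ x in E, Real.log ‖f x‖)
  else (⨍ x in E, ‖f x‖ ^ q) ^ (1 / q)

/-- The trigonometric polynomial `∑ a_k z^{α_k}` with `n + 1` terms, on the unit circle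
parametrised by `z = e^{2πix}`, `x ∈ ℝ/ℤ`. -/
def trigPoly {n : ℕ} (a : Fin (n + 1) → ℂ) (α : Fin (n + 1) → ℕ) (x : UnitAddCircle) : ℂ :=
  ∑ k, a k * fourier (α k : ℤ) x

/-- The Turán–Nazarov concentration inequality with constant `A`: for all `0 ≤ q ≤ 2`, all `n`,
all nonzero trigonometric polynomials with `n + 1` distinct frequencies in `ℕ`, and all measurable
`E` with `μ(E) ≥ 1/3`, one has `‖P‖_{L^q(E)} ≥ e^{-A n μ(𝕋∖E)} ‖P‖_{L^q(𝕋)}`.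
The measure on `ℝ/ℤ` has total mass `1`. -/
def TuranNazarov (A : ℝ) : Prop :=
  ∀ q : ℝ, 0 ≤ q → q ≤ 2 →
  ∀ (n : ℕ) (a : Fin (n + 1) → ℂ) (α : Fin (n + 1) → ℕ), a ≠ 0 → Function.Injective α →
  ∀ E : Set UnitAddCircle, MeasurableSet E → 1 / 3 ≤ volume.real E →
    Real.exp (-A * n * volume.real Eᶜ) * meanNorm q Set.univ (trigPoly a α)
      ≤ meanNorm q E (trigPoly a α)

/-- The `N × N` Toeplitz matrix with entries `sin(2πW(i-j)) / (π(i-j))`, and `2W` on the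
diagonal. -/
def dpssMatrix (N : ℕ) (W : ℝ) : Matrix (Fin N) (Fin N) ℝ :=
  fun i j => if i = j then 2 * W else
    Real.sin (2 * Real.pi * W * ((i : ℝ) - (j : ℝ))) / (Real.pi * ((i : ℝ) - (j : ℝ)))

theorem dpssMatrix_isHermitian (N : ℕ) (W : ℝ) : (dpssMatrix N W).IsHermitian := by
  ext i j
  simp only [Matrix.conjTranspose_apply, dpssMatrix, star_trivial]
  by_cases h : i = j
  · simp [h]
  · rw [if_neg h, if_neg (Ne.symm h)]
    rw [← neg_sub (i : ℝ) (j : ℝ), mul_neg, mul_neg, Real.sin_neg, neg_div_neg_eq]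

/-- Position `k` in the decreasing ordering of the eigenvalues, as an index of Mathlib's
eigenvector basis. -/
def dpssIndex (N : ℕ) (k : Fin N) : Fin N :=
  Fintype.equivOfCardEq (Fintype.card_fin (Fintype.card (Fin N)))
    (k.cast (Fintype.card_fin N).symm)

/-- The eigenvalue `λ_{k,N}(W)`, `0 ≤ k ≤ N - 1`, in decreasing order. -/
def dpssEigenvalue (N : ℕ) (W : ℝ) (k : Fin N) : ℝ :=
  (dpssMatrix_isHermitian N W).eigenvalues (dpssIndex N k)

theorem dpssEigenvalue_antitone (N : ℕ) (W : ℝ) : Antitone (dpssEigenvalue N W) := by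
  intro k l h
  simp only [dpssEigenvalue, dpssIndex, Matrix.IsHermitian.eigenvalues, Equiv.symm_apply_apply]
  exact (dpssMatrix_isHermitian N W).eigenvalues₀_antitone h

/-- The truncated discrete prolate spheroidal sequence `v^{(k)}`: a unit eigenvector of
`dpssMatrix N W` for `λ_{k,N}(W)`, the `v^{(k)}` being orthonormal. -/
def dpss (N : ℕ) (W : ℝ) (k : Fin N) : Fin N → ℝ :=
  fun j => (dpssMatrix_isHermitian N W).eigenvectorBasis (dpssIndex N k) j

theorem dpssMatrix_mulVec_dpss (N : ℕ) (W : ℝ) (k : Fin N) :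
    (dpssMatrix N W).mulVec (dpss N W k) = dpssEigenvalue N W k • dpss N W k :=
  (dpssMatrix_isHermitian N W).mulVec_eigenvectorBasis (dpssIndex N k)

/-- The discrete prolate spheroidal wave function
`U_{k,W}^N(x) = ε_k ∑_j v^{(k)}_j e^{-iπ(N-1-2j)x}`, `ε_k = 1` for even `k`, `ε_k = i` for odd
`k`. -/
def dpswf (N : ℕ) (W : ℝ) (k : Fin N) (x : ℝ) : ℂ :=
  (if Even (k : ℕ) then 1 else Complex.I) *
    ∑ j : Fin N, (dpss N W k j : ℂ) *
      Complex.exp (-(Complex.I * Real.pi * ((N : ℂ) - 1 - 2 * ((j : ℕ) : ℂ)) * x))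

end

/-!
Both lower bounds come from the single polynomial `(1 - z)ⁿ`. On the arc `|x| ≤ 1/6` one has
`|1 - e^{2πix}| = 2 |sin πx| ≤ 1`, while by Parseval its squared `L²` norm over the circle is
`∑ (n choose j)² = centralBinom n ≥ 4ⁿ / (2n)`. The arc has measure `1/3`.

Inserted into the inequality with `q = 2`, this gives `e^{-4An/3} centralBinom n ≤ 1`
for all `n`, hence `A ≥ (3/2) log 2` (`le_of_frequently_exp_mul_centralBinom_le_one`).

For the wave functions, the Toeplitz matrix is the quadratic form `∫_{-W}^{W} |Q|²` in the
coefficients of `Q` (`integral_sq_norm_sum_mul_exp`), and it is the identity for `W = 1/2`. So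
the squared mean norm of `U_{k,W}^N` over `(-W, W)` is `λ_{k,N}(W) / (2W)`, and its norm over the
period is `1`. By the minimum principle (`dpssEigenvalue_last_mul_le`), `λ_{N-1,N}(1/6)` is at most
the Rayleigh quotient of `(1 - z)^{N-1}`, that is, at most `1 / (3 centralBinom (N-1))`, and the same
growth comparison applies.

The bound obtained, `(3/2) log 2 ≈ 1.0397`, exceeds `3 log (12 / (eπ)) ≈ 1.0205`, because
`12 < √2 e π` (`log_twelve_div_le`).
-/

/-! ### The Toeplitz matrix as a quadratic form -/

/-- The squared modulus of a real combination of unimodular numbers, as a quadratic form. -/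
theorem sq_norm_sum_mul_exp_mul_I {ι : Type*} [Fintype ι] (v θ : ι → ℝ) :
    ‖∑ j, (v j : ℂ) * Complex.exp (θ j * Complex.I)‖ ^ 2 =
      ∑ j, ∑ l, v j * v l * Real.cos (θ j - θ l) := by
  have hre : (∑ j, (v j : ℂ) * Complex.exp (θ j * Complex.I)).re = ∑ j, v j * Real.cos (θ j) := by
    simp [Complex.re_sum, Complex.exp_ofReal_mul_I_re]
  have him : (∑ j, (v j : ℂ) * Complex.exp (θ j * Complex.I)).im = ∑ j, v j * Real.sin (θ j) := by
    simp [Complex.im_sum, Complex.exp_ofReal_mul_I_im]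
  rw [Complex.sq_norm, Complex.normSq_apply, hre, him, Finset.sum_mul_sum, Finset.sum_mul_sum,
    ← Finset.sum_add_distrib]
  refine Finset.sum_congr rfl fun j _ => ?_
  rw [← Finset.sum_add_distrib]
  refine Finset.sum_congr rfl fun l _ => ?_
  rw [Real.cos_sub]
  ring

theorem integral_cos_two_pi_mul_sub {N : ℕ} (W : ℝ) (j l : Fin N) :
    ∫ x in -W..W, Real.cos (2 * Real.pi * ((j : ℝ) - (l : ℝ)) * x) = dpssMatrix N W j l := by
  by_cases h : j = l
  · subst h
    simp [dpssMatrix]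
    ring
  · have hd : ((j : ℝ) - (l : ℝ)) ≠ 0 :=
      sub_ne_zero.2 fun h' => h (Fin.ext (by exact_mod_cast h'))
    have hc : 2 * Real.pi * ((j : ℝ) - (l : ℝ)) ≠ 0 := by positivity
    rw [intervalIntegral.integral_comp_mul_left (fun y => Real.cos y) hc, integral_cos, dpssMatrix,
      if_neg h, mul_neg, Real.sin_neg, smul_eq_mul,
      show 2 * Real.pi * W * ((j : ℝ) - l) = 2 * Real.pi * ((j : ℝ) - l) * W by ring]
    field_simp
    ring

/-- The Toeplitz matrix is the Gram form of the exponentials on `(-W, W)`. -/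
theorem integral_sq_norm_sum_mul_exp (N : ℕ) (W : ℝ) (v : Fin N → ℝ) :
    ∫ x in -W..W, ‖∑ j : Fin N, (v j : ℂ) *
        Complex.exp (-(Complex.I * Real.pi * ((N : ℂ) - 1 - 2 * ((j : ℕ) : ℂ)) * (x : ℝ)))‖ ^ 2 =
      ∑ j, ∑ l, v j * v l * dpssMatrix N W j l := by
  have h : ∀ x : ℝ, ‖∑ j : Fin N, (v j : ℂ) *
        Complex.exp (-(Complex.I * Real.pi * ((N : ℂ) - 1 - 2 * ((j : ℕ) : ℂ)) * (x : ℝ)))‖ ^ 2 =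
      ∑ j, ∑ l, v j * v l * Real.cos (2 * Real.pi * ((j : ℝ) - (l : ℝ)) * x) := by
    intro x
    have := sq_norm_sum_mul_exp_mul_I v fun j => -(Real.pi * ((N : ℝ) - 1 - 2 * (j : ℝ)) * x)
    convert this using 8
    · push_cast
      ring
    · ring
  simp_rw [h]
  rw [intervalIntegral.integral_finsetSum
    fun j _ => Continuous.intervalIntegrable (by fun_prop) _ _]
  refine Finset.sum_congr rfl fun j _ => ?_
  rw [intervalIntegral.integral_finsetSum
    fun l _ => Continuous.intervalIntegrable (by fun_prop) _ _]
  refine Finset.sum_congr rfl fun l _ => ?_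
  rw [intervalIntegral.integral_const_mul, integral_cos_two_pi_mul_sub]

/-- On the full period the exponentials are orthonormal. -/
theorem dpssMatrix_half (N : ℕ) : dpssMatrix N (1 / 2) = 1 := by
  ext i j
  by_cases h : i = j
  · subst h
    simp [dpssMatrix]
  · have : Real.sin (2 * Real.pi * (1 / 2) * ((i : ℝ) - (j : ℝ))) = 0 := by
      rw [show 2 * Real.pi * (1 / 2) * ((i : ℝ) - (j : ℝ)) = (((i : ℤ) - (j : ℤ) : ℤ) : ℝ) * Real.pi
        by push_cast; ring]
      exact Real.sin_int_mul_pi _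
    rw [dpssMatrix, if_neg h, this, zero_div, Matrix.one_apply_ne h]

/-! ### The minimum principle -/

/-- The minimum principle: the last eigenvalue is a lower bound for the quadratic form. -/
theorem dpssEigenvalue_last_mul_le (n : ℕ) (W : ℝ) (v : Fin (n + 1) → ℝ) :
    dpssEigenvalue (n + 1) W (Fin.last n) * ∑ j, v j ^ 2 ≤
      ∑ j, ∑ l, v j * v l * dpssMatrix (n + 1) W j l := by
  have hM := dpssMatrix_isHermitian (n + 1) W
  set b := hM.eigenvectorBasis with hb
  set u : EuclideanSpace ℝ (Fin (n + 1)) := WithLp.toLp 2 v with hu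
  set w : EuclideanSpace ℝ (Fin (n + 1)) := WithLp.toLp 2 ((dpssMatrix (n + 1) W).mulVec v) with hw
  have hlast : ∀ i, dpssEigenvalue (n + 1) W (Fin.last n) ≤ hM.eigenvalues i := by
    intro i
    obtain ⟨k, rfl⟩ : ∃ k, dpssIndex (n + 1) k = i := by
      refine ⟨((Fintype.equivOfCardEq (Fintype.card_fin (Fintype.card (Fin (n + 1))))).symm i).cast
        (Fintype.card_fin _), ?_⟩
      simp [dpssIndex]
    exact dpssEigenvalue_antitone (n + 1) W (Fin.le_last k)
  have hbw : ∀ i, inner ℝ (b i) w = hM.eigenvalues i * inner ℝ (b i) u := by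
    intro i
    have h1 := hM.mulVec_eigenvectorBasis i
    have h2 : (dpssMatrix (n + 1) W).transpose = dpssMatrix (n + 1) W := by
      simpa [Matrix.IsHermitian, Matrix.conjTranspose_eq_transpose_of_trivial] using hM
    simp only [EuclideanSpace.inner_eq_star_dotProduct, hw, hu, star_trivial]
    rw [← hb] at h1
    rw [dotProduct_comm, Matrix.dotProduct_mulVec, ← Matrix.mulVec_transpose, h2, h1,
      smul_dotProduct, dotProduct_comm, smul_eq_mul]
  have h1 : ∑ j, v j ^ 2 = ∑ i, inner ℝ u (b i) * inner ℝ (b i) u := by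
    rw [b.sum_inner_mul_inner, EuclideanSpace.inner_eq_star_dotProduct]
    simp [hu, dotProduct, sq]
  have h2 : ∑ j, ∑ l, v j * v l * dpssMatrix (n + 1) W j l =
      ∑ i, inner ℝ u (b i) * inner ℝ (b i) w := by
    rw [b.sum_inner_mul_inner, EuclideanSpace.inner_eq_star_dotProduct]
    simp only [hu, hw, dotProduct, Matrix.mulVec, star_trivial, Finset.sum_mul]
    refine Finset.sum_congr rfl fun j _ => Finset.sum_congr rfl fun l _ => ?_
    ring
  -- In the eigenbasis the claim is `λ_min ∑ cᵢ² ≤ ∑ λᵢ cᵢ²`.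
  rw [h1, h2, Finset.mul_sum]
  refine Finset.sum_le_sum fun i _ => ?_
  rw [hbw, real_inner_comm u (b i)]
  nlinarith [hlast i, mul_self_nonneg (inner ℝ (b i) u)]

/-! ### The test polynomial `(1 - z)ⁿ` -/

/-- The coefficient `(-1)^j (n choose j)` of `z^j` in `(1 - z)ⁿ`. -/
def altChoose (n : ℕ) (j : Fin (n + 1)) : ℝ := (-1) ^ (j : ℕ) * (n.choose j : ℝ)

theorem sum_altChoose_sq (n : ℕ) : ∑ j, altChoose n j ^ 2 = (n.centralBinom : ℝ) := by
  simp only [altChoose, mul_pow, ← pow_mul, mul_comm _ 2, pow_mul _ 2, neg_one_sq, one_pow, one_mul]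
  rw [Fin.sum_univ_eq_sum_range (fun j => ((n.choose j : ℕ) : ℝ) ^ 2), Nat.centralBinom,
    ← Nat.sum_range_choose_sq]
  push_cast
  rfl

theorem sum_altChoose_mul_pow (n : ℕ) (z : ℂ) :
    ∑ j : Fin (n + 1), (altChoose n j : ℂ) * z ^ (j : ℕ) = (1 - z) ^ n := by
  rw [sub_eq_neg_add, add_pow, ← Fin.sum_univ_eq_sum_range
    (fun j => (-z) ^ j * 1 ^ (n - j) * (n.choose j : ℂ))]
  refine Finset.sum_congr rfl fun j _ => ?_
  rw [altChoose, neg_pow z]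
  push_cast
  ring

theorem norm_one_sub_exp_two_pi (x : ℝ) :
    ‖1 - Complex.exp (2 * Real.pi * Complex.I * x)‖ = 2 * |Real.sin (Real.pi * x)| := by
  have := Complex.norm_exp_I_mul_ofReal_sub_one (2 * Real.pi * x)
  rw [Real.norm_eq_abs, abs_mul, abs_two, mul_assoc 2 Real.pi x,
    mul_div_cancel_left₀ _ (two_ne_zero' ℝ)] at this
  rw [norm_sub_rev, ← this]
  congr 3
  push_cast
  ring

theorem two_mul_abs_sin_le_one {x : ℝ} (hx : |x| ≤ 1 / 6) : 2 * |Real.sin (Real.pi * x)| ≤ 1 := by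
  have hpi := Real.pi_pos
  have h : |Real.pi * x| ≤ Real.pi / 6 := by
    rw [abs_mul, abs_of_pos hpi]
    nlinarith
  rw [Real.abs_sin_eq_sin_abs_of_abs_le_pi (by linarith)]
  have := Real.sin_le_sin_of_le_of_le_pi_div_two (by linarith [abs_nonneg (Real.pi * x)])
    (by linarith) h
  rw [Real.sin_pi_div_six] at this
  linarith

/-- Centring the frequencies multiplies `(1 - z)ⁿ` by a unimodular factor. -/
theorem norm_sum_altChoose_mul_exp (n : ℕ) (x : ℝ) :
    ‖∑ j : Fin (n + 1), (altChoose n j : ℂ) *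
        Complex.exp (-(Complex.I * Real.pi * (((n + 1 : ℕ) : ℂ) - 1 - 2 * ((j : ℕ) : ℂ)) * x))‖ =
      ‖1 - Complex.exp (2 * Real.pi * Complex.I * x)‖ ^ n := by
  have h : ∑ j : Fin (n + 1), (altChoose n j : ℂ) *
        Complex.exp (-(Complex.I * Real.pi * (((n + 1 : ℕ) : ℂ) - 1 - 2 * ((j : ℕ) : ℂ)) * x)) =
      Complex.exp ((-(Real.pi * n * x) : ℝ) * Complex.I) *
        (1 - Complex.exp (2 * Real.pi * Complex.I * x)) ^ n := by
    rw [← sum_altChoose_mul_pow, Finset.mul_sum]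
    refine Finset.sum_congr rfl fun j _ => ?_
    rw [← Complex.exp_nat_mul, mul_left_comm, ← Complex.exp_add]
    congr 2
    push_cast
    ring
  rw [h, norm_mul, Complex.norm_exp_ofReal_mul_I, one_mul, norm_pow]

/-- By Parseval, `(1 - z)ⁿ` has squared mean `centralBinom n` over the circle. -/
theorem integral_norm_one_sub_exp_pow (n : ℕ) :
    ∫ x in -(1 / 2 : ℝ)..1 / 2, (‖1 - Complex.exp (2 * Real.pi * Complex.I * (x : ℝ))‖ ^ n) ^ 2 =
      n.centralBinom := by
  simp_rw [← norm_sum_altChoose_mul_exp]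
  rw [integral_sq_norm_sum_mul_exp, dpssMatrix_half, ← sum_altChoose_sq]
  simp [Matrix.one_apply, sq]

/-- The smallest eigenvalue is at most the Rayleigh quotient of `(1 - z)ⁿ`, whose modulus is at
most `1` on the arc `(-1/6, 1/6)`. -/
theorem dpssEigenvalue_last_mul_centralBinom_le (n : ℕ) :
    dpssEigenvalue (n + 1) (1 / 6) (Fin.last n) * n.centralBinom ≤ 1 / 3 := by
  have h := dpssEigenvalue_last_mul_le n (1 / 6) (altChoose n)
  rw [sum_altChoose_sq, ← integral_sq_norm_sum_mul_exp] at h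
  refine h.trans ?_
  simp_rw [norm_sum_altChoose_mul_exp]
  calc ∫ x in -(1 / 6 : ℝ)..1 / 6,
        (‖1 - Complex.exp (2 * Real.pi * Complex.I * (x : ℝ))‖ ^ n) ^ 2
      ≤ ∫ x in -(1 / 6 : ℝ)..1 / 6, (1 : ℝ) := by
        refine intervalIntegral.integral_mono_on (by norm_num)
          (Continuous.intervalIntegrable (by fun_prop) _ _)
          (Continuous.intervalIntegrable (by fun_prop) _ _) fun x hx => ?_
        rw [norm_one_sub_exp_two_pi]
        exact pow_le_one₀ (by positivity) (pow_le_one₀ (by positivity)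
          (two_mul_abs_sin_le_one (abs_le.2 hx)))
    _ = 1 / 3 := by norm_num

/-! ### Norms of the wave functions -/

theorem meanNorm_two {X : Type*} [MeasureSpace X] (E : Set X) (f : X → ℂ) :
    meanNorm 2 E f = √(⨍ x in E, ‖f x‖ ^ 2) := by
  rw [meanNorm, if_neg two_ne_zero, Real.sqrt_eq_rpow]
  norm_cast

theorem meanNorm_two_Ioo {W : ℝ} (hW : 0 < W) (f : ℝ → ℂ) :
    meanNorm 2 (Set.Ioo (-W) W) f = √((∫ x in -W..W, ‖f x‖ ^ 2) / (2 * W)) := by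
  rw [meanNorm_two, setAverage_eq, intervalIntegral.integral_of_le (by linarith),
    integral_Ioc_eq_integral_Ioo, Measure.real, Real.volume_Ioo, ENNReal.toReal_ofReal (by linarith),
    smul_eq_mul, sub_neg_eq_add, ← two_mul, div_eq_inv_mul]

theorem sum_dpss_sq (N : ℕ) (W : ℝ) (k : Fin N) : ∑ j, dpss N W k j ^ 2 = 1 := by
  have h := (dpssMatrix_isHermitian N W).eigenvectorBasis.orthonormal.1 (dpssIndex N k)
  rw [EuclideanSpace.norm_eq, Real.sqrt_eq_one] at h
  simpa [dpss] using h

theorem sum_dpss_mul_dpssMatrix (N : ℕ) (W : ℝ) (k : Fin N) :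
    ∑ j, ∑ l, dpss N W k j * dpss N W k l * dpssMatrix N W j l = dpssEigenvalue N W k := by
  have h : ∀ j, ∑ l, dpss N W k j * dpss N W k l * dpssMatrix N W j l =
      dpssEigenvalue N W k * dpss N W k j ^ 2 := by
    intro j
    have := congrFun (dpssMatrix_mulVec_dpss N W k) j
    simp only [Matrix.mulVec, dotProduct, Pi.smul_apply, smul_eq_mul] at this
    rw [sq, mul_left_comm, ← this, Finset.mul_sum]
    exact Finset.sum_congr rfl fun l _ => by ring
  simp_rw [h]
  rw [← Finset.mul_sum, sum_dpss_sq, mul_one]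

theorem norm_dpswf (N : ℕ) (W : ℝ) (k : Fin N) (x : ℝ) :
    ‖dpswf N W k x‖ = ‖∑ j : Fin N, (dpss N W k j : ℂ) *
      Complex.exp (-(Complex.I * Real.pi * ((N : ℂ) - 1 - 2 * ((j : ℕ) : ℂ)) * x))‖ := by
  rw [dpswf, norm_mul]
  split_ifs <;> simp

theorem meanNorm_two_dpswf_period (N : ℕ) (W : ℝ) (k : Fin N) :
    meanNorm 2 (Set.Ioo (-(1 / 2)) (1 / 2)) (dpswf N W k) = 1 := by
  rw [meanNorm_two_Ioo (by norm_num)]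
  simp_rw [norm_dpswf]
  rw [integral_sq_norm_sum_mul_exp, dpssMatrix_half]
  have := sum_dpss_sq N W k
  simp [Matrix.one_apply, ← sq, this]

theorem meanNorm_two_dpswf {W : ℝ} (hW : 0 < W) (N : ℕ) (k : Fin N) :
    meanNorm 2 (Set.Ioo (-W) W) (dpswf N W k) = √(dpssEigenvalue N W k / (2 * W)) := by
  rw [meanNorm_two_Ioo hW]
  simp_rw [norm_dpswf]
  rw [integral_sq_norm_sum_mul_exp, sum_dpss_mul_dpssMatrix]

/-! ### The polynomial `(1 - z)ⁿ` in the Turán–Nazarov inequality -/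

theorem norm_trigPoly_altChoose (n : ℕ) (x : ℝ) :
    ‖trigPoly (fun j => (altChoose n j : ℂ)) (fun j : Fin (n + 1) => (j : ℕ)) (x : UnitAddCircle)‖ =
      ‖1 - Complex.exp (2 * Real.pi * Complex.I * x)‖ ^ n := by
  rw [← norm_pow, ← sum_altChoose_mul_pow, trigPoly]
  congr 1
  refine Finset.sum_congr rfl fun j _ => ?_
  rw [fourier_coe_apply, ← Complex.exp_nat_mul]
  congr 2
  push_cast
  ring

theorem meanNorm_two_univ_trigPoly_altChoose (n : ℕ) :
    meanNorm 2 Set.univ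
      (trigPoly (fun j => (altChoose n j : ℂ)) (fun j : Fin (n + 1) => (j : ℕ))) =
      √(n.centralBinom : ℝ) := by
  rw [meanNorm_two, setAverage_eq, Measure.restrict_univ,
    ← UnitAddCircle.intervalIntegral_preimage (-(1 / 2)),
    show (-(1 / 2) + 1 : ℝ) = 1 / 2 by norm_num, ← integral_norm_one_sub_exp_pow]
  simp [norm_trigPoly_altChoose, Measure.real]

theorem norm_trigPoly_altChoose_le_one (n : ℕ) {x : UnitAddCircle} (hx : ‖x‖ ≤ 1 / 6) :
    ‖trigPoly (fun j => (altChoose n j : ℂ)) (fun j : Fin (n + 1) => (j : ℕ)) x‖ ≤ 1 := by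
  obtain ⟨y, rfl⟩ := QuotientAddGroup.mk_surjective x
  rw [UnitAddCircle.norm_eq] at hx
  have hy : (QuotientAddGroup.mk y : UnitAddCircle) = ((y - round y : ℝ) : UnitAddCircle) := by
    rw [AddCircle.coe_sub, eq_comm, sub_eq_self]
    exact (AddCircle.coe_eq_zero_iff 1).2 ⟨round y, by simp⟩
  rw [hy, norm_trigPoly_altChoose, norm_one_sub_exp_two_pi]
  exact pow_le_one₀ (by positivity) (two_mul_abs_sin_le_one hx)

theorem volume_real_closedBall_sixth :
    volume.real (Metric.closedBall (0 : UnitAddCircle) (1 / 6)) = 1 / 3 := by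
  rw [Measure.real, AddCircle.volume_closedBall, ENNReal.toReal_ofReal (by positivity)]
  norm_num

theorem meanNorm_two_le_one {X : Type*} [MeasureSpace X] {E : Set X} (hE : volume E ≠ ⊤)
    {f : X → ℂ} (hf : ∀ x ∈ E, ‖f x‖ ≤ 1) : meanNorm 2 E f ≤ 1 := by
  have h : ‖∫ x in E, ‖f x‖ ^ 2‖ ≤ 1 * volume.real E :=
    norm_setIntegral_le_of_norm_le_const hE.lt_top fun x hx => by
      rw [norm_pow, norm_norm]
      exact pow_le_one₀ (norm_nonneg _) (hf x hx)
  rw [meanNorm_two, setAverage_eq, Real.sqrt_le_one, smul_eq_mul, ← div_eq_inv_mul]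
  exact div_le_one_of_le₀ ((le_abs_self _).trans (by simpa using h)) measureReal_nonneg

/-! ### The growth rate -/

/-- Since `4ⁿ ≤ 2 n centralBinom n`, the hypothesis gives `(4 e^{-4A/3})ⁿ ≤ 2n` for arbitrarily
large `n`, so the base is at most `1`. -/
theorem le_of_frequently_exp_mul_centralBinom_le_one {A : ℝ}
    (h : ∃ᶠ n : ℕ in atTop, Real.exp (-A * n * (2 / 3)) ^ 2 * n.centralBinom ≤ 1) :
    3 / 2 * Real.log 2 ≤ A := by
  by_contra! hA
  have hr : 1 < 4 * Real.exp (-A * (4 / 3)) := by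
    have h4 : Real.exp (2 * Real.log 2) = 4 := by
      rw [two_mul, Real.exp_add, Real.exp_log two_pos]
      norm_num
    have h5 : 4 * Real.exp (-A * (4 / 3)) = Real.exp (2 * Real.log 2 + -A * (4 / 3)) := by
      rw [Real.exp_add, h4]
    rw [h5, Real.one_lt_exp_iff]
    linarith
  have ht := tendsto_pow_const_div_const_pow_of_one_lt 1 hr
  have hlt : ∀ᶠ n : ℕ in atTop, (n : ℝ) ^ 1 / (4 * Real.exp (-A * (4 / 3))) ^ n < 1 / 2 :=
    ht.eventually_lt_const (by norm_num)
  obtain ⟨n, hn, hn', hn0⟩ := (h.and_eventually (hlt.and (eventually_gt_atTop 0))).exists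
  have hc : (4 : ℝ) ^ n ≤ 2 * n * n.centralBinom := by
    exact_mod_cast Nat.four_pow_le_two_mul_self_mul_centralBinom n hn0
  have he : Real.exp (-A * n * (2 / 3)) ^ 2 = Real.exp (-A * (4 / 3)) ^ n := by
    rw [← Real.exp_nat_mul, ← Real.exp_nat_mul]
    congr 1
    push_cast
    ring
  rw [he] at hn
  rw [pow_one, div_lt_iff₀ (by positivity), mul_pow] at hn'
  have hpos : 0 < Real.exp (-A * (4 / 3)) ^ n := by positivity
  have hn1 : (0 : ℝ) < n := by exact_mod_cast hn0
  nlinarith [mul_le_mul_of_nonneg_right hc hpos.le, mul_le_mul_of_nonneg_left hn hn1.le]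

theorem TuranNazarov.three_halves_mul_log_two_le {A : ℝ} (h : TuranNazarov A) :
    3 / 2 * Real.log 2 ≤ A := by
  refine le_of_frequently_exp_mul_centralBinom_le_one (Frequently.of_forall fun n => ?_)
  have hne : (fun j => (altChoose n j : ℂ)) ≠ 0 := fun h0 => by
    simpa [altChoose] using congrFun h0 0
  have hm : MeasurableSet (Metric.closedBall (0 : UnitAddCircle) (1 / 6)) :=
    Metric.isClosed_closedBall.measurableSet
  have hcompl : volume.real (Metric.closedBall (0 : UnitAddCircle) (1 / 6))ᶜ = 2 / 3 := by
    rw [measureReal_compl hm, volume_real_closedBall_sixth]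
    simp [Measure.real]
    norm_num
  have key := (h 2 zero_le_two le_rfl n _ _ hne Fin.val_injective _ hm
    volume_real_closedBall_sixth.ge).trans
    (meanNorm_two_le_one (measure_ne_top _ _) fun x hx =>
      norm_trigPoly_altChoose_le_one n (by simpa using hx))
  rw [hcompl, meanNorm_two_univ_trigPoly_altChoose] at key
  have := pow_le_one₀ (n := 2) (by positivity) key
  rwa [mul_pow, Real.sq_sqrt (by positivity)] at this

theorem three_halves_mul_log_two_le_of_dpswf {A : ℝ}
    (h : ∃ᶠ N : ℕ in atTop, ∃ hN : 0 < N,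
        Real.exp (-A * ((N : ℝ) - 1) * (1 - 2 * (1 / 6))) *
            meanNorm 2 (Set.Ioo (-(1 / 2)) (1 / 2)) (dpswf N (1 / 6) ⟨N - 1, Nat.sub_one_lt_of_lt hN⟩)
          ≤ meanNorm 2 (Set.Ioo (-(1 / 6)) (1 / 6))
              (dpswf N (1 / 6) ⟨N - 1, Nat.sub_one_lt_of_lt hN⟩)) :
    3 / 2 * Real.log 2 ≤ A := by
  refine le_of_frequently_exp_mul_centralBinom_le_one ((tendsto_sub_atTop_nat 1).frequently
    (h.mono ?_))
  rintro N ⟨hN, key⟩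
  obtain ⟨n, rfl⟩ : ∃ n, N = n + 1 := ⟨N - 1, by omega⟩
  rw [meanNorm_two_dpswf_period, meanNorm_two_dpswf (by norm_num), mul_one] at key
  have hev := dpssEigenvalue_last_mul_centralBinom_le n
  have hexp : -A * (((n + 1 : ℕ) : ℝ) - 1) * (1 - 2 * (1 / 6)) = -A * n * (2 / 3) := by
    push_cast
    ring
  rw [hexp, Real.le_sqrt' (Real.exp_pos _)] at key
  have hc : (0 : ℝ) ≤ n.centralBinom := by positivity
  rw [Nat.add_sub_cancel]
  refine (mul_le_mul_of_nonneg_right key hc).trans ?_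
  have : dpssEigenvalue (n + 1) (1 / 6) ⟨n + 1 - 1, Nat.sub_one_lt_of_lt hN⟩ =
    dpssEigenvalue (n + 1) (1 / 6) (Fin.last n) := rfl
  rw [this, div_mul_eq_mul_div, div_le_one (by norm_num)]
  linarith

/-! ### Numerical bounds -/

/-- Equivalent to `12 / √2 ≤ e π`, where `12 / √2 ≈ 8.4853` and `e π ≈ 8.5397`. -/
theorem log_twelve_div_le : 2 / (1 - 2 / 6) * Real.log (12 / (Real.exp 1 * Real.pi)) ≤
    3 / 2 * Real.log 2 := by
  have he := Real.exp_one_gt_d9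
  have hpi := Real.pi_gt_d4
  have hep : 8.53 ≤ Real.exp 1 * Real.pi := by nlinarith
  have h : (12 / (Real.exp 1 * Real.pi)) ^ 2 ≤ 2 := by
    rw [div_pow, div_le_iff₀ (by positivity)]
    nlinarith
  have hl := Real.log_le_log (by positivity) h
  rw [Real.log_pow] at hl
  push_cast at hl
  linarith

theorem abs_log_twelve_div_sub_lt :
    |2 / (1 - 2 / 6) * Real.log (12 / (Real.exp 1 * Real.pi)) - 1.02| < 0.005 := by
  have he := Real.exp_one_gt_d9
  have he' := Real.exp_one_lt_d9
  have hpi := Real.pi_gt_d4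
  have hpi' := Real.pi_lt_d4
  have hpos : 0 < 12 / (Real.exp 1 * Real.pi) := by positivity
  have hlow : 0.339 < Real.log (12 / (Real.exp 1 * Real.pi)) := by
    rw [Real.lt_log_iff_exp_lt hpos]
    have h := Real.exp_bound' (x := 0.339) (by norm_num) (by norm_num) (n := 5) (by norm_num)
    norm_num [Finset.sum_range_succ, Nat.factorial] at h
    have h' : Real.exp 0.339 < 1.4037 := by
      norm_num
      linarith
    refine h'.trans ?_
    rw [lt_div_iff₀ (by positivity)]
    nlinarith
  have hup : Real.log (12 / (Real.exp 1 * Real.pi)) < 0.341 := by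
    rw [Real.log_lt_iff_lt_exp hpos]
    have h := Real.sum_le_exp_of_nonneg (x := 0.341) (by norm_num) 5
    norm_num [Finset.sum_range_succ, Nat.factorial] at h
    have h' : 1.4062 < Real.exp 0.341 := by
      norm_num
      linarith
    refine lt_trans ?_ h'
    rw [div_lt_iff₀ (by positivity)]
    nlinarith
  rw [abs_lt]
  constructor <;> linarith

theorem mainTheorem9 (A : ℝ) :
    (TuranNazarov A →
      2 / (1 - 2 / 6) * Real.log (12 / (Real.exp 1 * Real.pi)) ≤ A) ∧
    ((∃ᶠ N : ℕ in atTop, ∃ hN : 0 < N,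
        Real.exp (-A * ((N : ℝ) - 1) * (1 - 2 * (1 / 6))) *
            meanNorm 2 (Set.Ioo (-(1 / 2)) (1 / 2)) (dpswf N (1 / 6) ⟨N - 1, Nat.sub_one_lt_of_lt hN⟩)
          ≤ meanNorm 2 (Set.Ioo (-(1 / 6)) (1 / 6))
              (dpswf N (1 / 6) ⟨N - 1, Nat.sub_one_lt_of_lt hN⟩)) →
      2 / (1 - 2 / 6) * Real.log (12 / (Real.exp 1 * Real.pi)) ≤ A) ∧
    |2 / (1 - 2 / 6) * Real.log (12 / (Real.exp 1 * Real.pi)) - 1.02| < 0.005 := by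
  exact ⟨fun h => log_twelve_div_le.trans h.three_halves_mul_log_two_le,
    fun h => log_twelve_div_le.trans (three_halves_mul_log_two_le_of_dpswf h),
    abs_log_twelve_div_sub_lt⟩
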